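/- **Conventions.** A partially ordered group is a group $G$ with a partial order invariant under left and right multiplication; $G^+=\{a\in G\mid a\ge \mathrm e\}$. An $\ell$-group is a partially ordered group whose order is a lattice order; a variety of $\ell$-groups is a class of $\ell$-groups defined by a set of equations in the language of groups and lattices; $\ell$-homomorphisms are group homomorphisms that are lattice homomorphisms. For a chain $\Omega$, $\mathrm{Aut}(\Omega)$ is the $\ell$-group of its order-preserving bijections with pointwise order and with $f\cdot g$ meaning "$g$ after $f$". **Right pre-orders.** Let $G$ be a partially ordered group. A right pre-order on $G$ is (identified with) a proper submonoid $C\subsetneq G$ with $G=C\cup C^{-1}$ and $G^+\subseteq C$; its relation is $a\preceq_C b\iff ba^{-1}\in C$. It is a pre-order if $\preceq_C$ is also left invariant. Let $\Omega_C$ be the chain of classes $[a]$ of $G$ modulo ($a\preceq_C b$ and $b\preceq_C a$), ordered by $[a]\le[b]\iff a\preceq_C b$, let $R_C(a)\colon[b]\mapsto[ba]$, and let $H_C$ be the $\ell$-subgroup of $\mathrm{Aut}(\Omega_C)$ generated by $\{R_C(a)\mid a\in G\}$. For a variety $V$ of $\ell$-groups let $\mathcal P_V(G)$ be the set of right pre-orders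 $C$ on $G$ with $H_C\in V$, with the smallest topology containing the sets $\{C\mid a\in C,\ a^{-1}\notin C\}$, $a\in G$; let $\mathcal B_V(G)$ be its subspace of pre-orders. **Spectra.** For an $\ell$-group $H$, a convex $\ell$-subgroup is an order-convex sublattice subgroup $\mathfrak p$; its right cosets are ordered by $\mathfrak p x\le\mathfrak p y\iff x\le ty$ for some $t\in\mathfrak p$. It is prime if $\mathfrak p\ne H$ and this order is total. $\mathrm{Spec}\,H$ is the set of prime convex $\ell$-subgroups, with open sets $\{\mathfrak p\mid A\not\subseteq\mathfrak p\}$, $A\subseteq H$; $\mathrm{Spec}^*H$ is its subspace of normal members (prime ideals). **The maps.** Let $\eta\colon G\to F_V(G)$ be the universal order-preserving homomorphism from $G$ to the $\ell$-group free over $G$ in $V$. For $C\in\mathcal P_V(G)$ let $h_C\colon F_V(G)\to H_C$ be the unique $\ell$-homomorphism with $h_C\circ\eta=R_C$, and put $$\kappa(C)=\{x\in F_V(G)\mid h_C(x)([\mathrm e])=[\mathrm e]\}.$$ For $\mathfrak p\in\mathrm{Spec}\,F_V(G)$ put $a\preceq_{\mathfrak p}b\iff\mathfrak p\,\eta(a)\le\mathfrak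 p\,\eta(b)$ and $$\pi(\mathfrak p)=\{a\in G\mid \mathrm e\preceq_{\mathfrak p}a\}.$$ **Theorem 2.5.** For every partially ordered group $G$ and every variety $V$ of $\ell$-groups, these formulas give well-defined maps $\kappa\colon\mathcal P_V(G)\to\mathrm{Spec}\,F_V(G)$ and $\pi\colon\mathrm{Spec}\,F_V(G)\to\mathcal P_V(G)$ (and $\preceq_{\mathfrak p}$ is the relation of $\pi(\mathfrak p)$). They are mutually inverse, inclusion-preserving homeomorphisms, and they restrict to homeomorphisms between $\mathcal B_V(G)$ and $\mathrm{Spec}^*F_V(G)$. -/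

import Mathlib

universe u v

namespace LGrp

/-! ## Terms, varieties, homomorphisms, `ℓ`-subgroups

A partially ordered group is a type with `[Group G] [PartialOrder G] [MulLeftMono G]
[MulRightMono G]`; an `ℓ`-group is the same with `[Lattice H]` in place of `[PartialOrder G]`. -/

/-- Terms in the language of `ℓ`-groups with variables from `X`. -/
inductive LTerm (X : Type u) : Type u
  | var : X → LTerm X
  | one : LTerm X
  | mul : LTerm X → LTerm X → LTerm X
  | inv : LTerm X → LTerm X
  | sup : LTerm X → LTerm X → LTerm X
  | inf : LTerm X → LTerm X → LTerm X

/-- Value of a term under an assignment of its variables. -/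
def LTerm.eval {X : Type u} {H : Type v} [Group H] [Lattice H] (f : X → H) : LTerm X → H
  | .var x => f x
  | .one => 1
  | .mul s t => s.eval f * t.eval f
  | .inv s => (s.eval f)⁻¹
  | .sup s t => s.eval f ⊔ t.eval f
  | .inf s t => s.eval f ⊓ t.eval f

/-- Substitution of terms for the variables of a term. -/
def LTerm.subst {X : Type u} {Y : Type v} (σ : X → LTerm Y) : LTerm X → LTerm Y
  | .var x => σ x
  | .one => .one
  | .mul s t => .mul (s.subst σ) (t.subst σ)
  | .inv s => .inv (s.subst σ)
  | .sup s t => .sup (s.subst σ) (t.subst σ)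
  | .inf s t => .inf (s.subst σ) (t.subst σ)

/-- A set of equations between terms in countably many variables. A variety of `ℓ`-groups is
the class of all `ℓ`-groups that satisfy such a set of equations. -/
abbrev Equations : Type := Set (LTerm ℕ × LTerm ℕ)

/-- The `ℓ`-group `H` belongs to the variety axiomatised by `E`. -/
def InVariety (E : Equations) (H : Type v) [Group H] [Lattice H] : Prop :=
  ∀ e ∈ E, ∀ f : ℕ → H, e.1.eval f = e.2.eval f

/-- An `ℓ`-homomorphism: a group homomorphism that is also a lattice homomorphism. -/
structure LHom (H : Type u) (K : Type v) [Group H] [Lattice H] [Group K] [Lattice K]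
    extends H →* K where
  map_sup' : ∀ x y : H, toFun (x ⊔ y) = toFun x ⊔ toFun y
  map_inf' : ∀ x y : H, toFun (x ⊓ y) = toFun x ⊓ toFun y

instance LHom.instFunLike {H : Type u} {K : Type v} [Group H] [Lattice H] [Group K] [Lattice K] :
    FunLike (LHom H K) H K where
  coe h := h.toFun
  coe_injective h k e := by
    obtain ⟨⟨⟨f, _⟩, _⟩, _, _⟩ := h
    obtain ⟨⟨⟨g, _⟩, _⟩, _, _⟩ := k
    have hfg : f = g := e
    subst hfg
    rfl

/-- An `ℓ`-subgroup: a subgroup that is a sublattice. -/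
structure LSubgroup (H : Type u) [Group H] [Lattice H] extends Subgroup H where
  sup_mem' : ∀ {x y : H}, x ∈ carrier → y ∈ carrier → x ⊔ y ∈ carrier
  inf_mem' : ∀ {x y : H}, x ∈ carrier → y ∈ carrier → x ⊓ y ∈ carrier

section LSubgroup

variable {H : Type u} [Group H] [Lattice H]

instance LSubgroup.instSetLike : SetLike (LSubgroup H) H where
  coe K := K.carrier
  coe_injective K L e := by
    obtain ⟨K, _, _⟩ := K
    obtain ⟨L, _, _⟩ := L
    have hKL : K = L := SetLike.coe_injective e
    subst hKL
    rfl

instance LSubgroup.instSubgroupClass : SubgroupClass (LSubgroup H) H where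
  mul_mem {K} := K.toSubgroup.mul_mem
  one_mem K := K.toSubgroup.one_mem
  inv_mem {K} := K.toSubgroup.inv_mem

/-- The lattice structure inherited by an `ℓ`-subgroup. -/
instance LSubgroup.instLattice (K : LSubgroup H) : Lattice K :=
  Subtype.lattice (fun _ _ hx hy => K.sup_mem' hx hy) (fun _ _ hx hy => K.inf_mem' hx hy)

instance LSubgroup.instMulLeftMono [MulLeftMono H] (K : LSubgroup H) : MulLeftMono K where
  elim a b c h := by
    change (a : H) * (b : H) ≤ (a : H) * (c : H)
    have h' : (b : H) ≤ (c : H) := h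
    exact mul_le_mul_right h' _

instance LSubgroup.instMulRightMono [MulRightMono H] (K : LSubgroup H) : MulRightMono K where
  elim a b c h := by
    change (b : H) * (a : H) ≤ (c : H) * (a : H)
    have h' : (b : H) ≤ (c : H) := h
    exact mul_le_mul_left h' _

/-- The `ℓ`-subgroup generated by a set: the intersection of all `ℓ`-subgroups containing it. -/
def LSubgroup.closure (S : Set H) : LSubgroup H where
  carrier := {x | ∀ K : LSubgroup H, S ⊆ K → x ∈ K}
  mul_mem' hx hy K hK := mul_mem (hx K hK) (hy K hK)
  one_mem' K _ := one_mem K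
  inv_mem' hx K hK := inv_mem (hx K hK)
  sup_mem' hx hy K hK := K.sup_mem' (hx K hK) (hy K hK)
  inf_mem' hx hy K hK := K.inf_mem' (hx K hK) (hy K hK)

theorem LSubgroup.subset_closure (S : Set H) : S ⊆ LSubgroup.closure S :=
  fun _ hx _ hK => hK hx

end LSubgroup

/-! ## The `ℓ`-group of automorphisms of a chain -/

/-- The order-preserving bijections of a chain. -/
def ChainAut (Ω : Type u) [LinearOrder Ω] : Type u := Ω ≃o Ω

namespace ChainAut

variable {Ω : Type u} [LinearOrder Ω]

instance : FunLike (ChainAut Ω) Ω Ω where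
  coe f := (show Ω ≃o Ω from f).toFun
  coe_injective _ _ e := DFunLike.coe_injective (F := Ω ≃o Ω) e

theorem ext {f g : ChainAut Ω} (h : ∀ x, f x = g x) : f = g := DFunLike.ext f g h

/-- The product `f * g` is `g` after `f`. -/
instance : Group (ChainAut Ω) where
  mul f g := OrderIso.trans (show Ω ≃o Ω from f) (show Ω ≃o Ω from g)
  one := OrderIso.refl Ω
  inv f := OrderIso.symm (show Ω ≃o Ω from f)
  mul_assoc _ _ _ := rfl
  one_mul _ := rfl
  mul_one _ := rfl
  inv_mul_cancel f := ext fun x => (show Ω ≃o Ω from f).apply_symm_apply x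

theorem mul_apply (f g : ChainAut Ω) (x : Ω) : (f * g) x = g (f x) := rfl

theorem one_apply (x : Ω) : (1 : ChainAut Ω) x = x := rfl

theorem inv_apply_self (f : ChainAut Ω) (x : Ω) : f⁻¹ (f x) = x :=
  (show Ω ≃o Ω from f).symm_apply_apply x

theorem apply_inv_self (f : ChainAut Ω) (x : Ω) : f (f⁻¹ x) = x :=
  (show Ω ≃o Ω from f).apply_symm_apply x

theorem mono (f : ChainAut Ω) : Monotone f := (show Ω ≃o Ω from f).monotone

theorem sup_inf_inv (f g : ChainAut Ω) (x : Ω) :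
    f (f⁻¹ x ⊓ g⁻¹ x) ⊔ g (f⁻¹ x ⊓ g⁻¹ x) = x := by
  rw [f.mono.map_inf, g.mono.map_inf, apply_inv_self, apply_inv_self]
  rcases le_total (f⁻¹ x) (g⁻¹ x) with h | h
  · have h1 := f.mono h
    have h2 := g.mono h
    rw [apply_inv_self] at h1 h2
    rw [inf_eq_left.2 h1, inf_eq_left.2 h2, sup_eq_left.2 h2]
  · have h1 := f.mono h
    have h2 := g.mono h
    rw [apply_inv_self] at h1 h2
    rw [inf_eq_right.2 h1, inf_eq_right.2 h2, sup_eq_right.2 h1]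

theorem inf_sup_inv (f g : ChainAut Ω) (x : Ω) :
    f (f⁻¹ x ⊔ g⁻¹ x) ⊓ g (f⁻¹ x ⊔ g⁻¹ x) = x := by
  rw [f.mono.map_sup, g.mono.map_sup, apply_inv_self, apply_inv_self]
  rcases le_total (f⁻¹ x) (g⁻¹ x) with h | h
  · have h1 := f.mono h
    have h2 := g.mono h
    rw [apply_inv_self] at h1 h2
    rw [sup_eq_right.2 h1, sup_eq_right.2 h2, inf_eq_right.2 h1]
  · have h1 := f.mono h
    have h2 := g.mono h
    rw [apply_inv_self] at h1 h2
    rw [sup_eq_left.2 h1, sup_eq_left.2 h2, inf_eq_left.2 h2]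

/-- The pointwise supremum of two automorphisms. -/
def sup (f g : ChainAut Ω) : ChainAut Ω :=
  Equiv.toOrderIso
    { toFun := fun x => f x ⊔ g x
      invFun := fun x => f⁻¹ x ⊓ g⁻¹ x
      left_inv := fun x => by simpa using inf_sup_inv f⁻¹ g⁻¹ x
      right_inv := fun x => sup_inf_inv f g x }
    (fun _ _ h => sup_le_sup (f.mono h) (g.mono h))
    (fun _ _ h => inf_le_inf (f⁻¹.mono h) (g⁻¹.mono h))

/-- The pointwise infimum of two automorphisms. -/
def inf (f g : ChainAut Ω) : ChainAut Ω :=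
  Equiv.toOrderIso
    { toFun := fun x => f x ⊓ g x
      invFun := fun x => f⁻¹ x ⊔ g⁻¹ x
      left_inv := fun x => by simpa using sup_inf_inv f⁻¹ g⁻¹ x
      right_inv := fun x => inf_sup_inv f g x }
    (fun _ _ h => inf_le_inf (f.mono h) (g.mono h))
    (fun _ _ h => sup_le_sup (f⁻¹.mono h) (g⁻¹.mono h))

/-- The pointwise order and lattice operations. -/
instance : Lattice (ChainAut Ω) where
  le f g := ∀ x, f x ≤ g x
  le_refl f x := le_refl (f x)
  le_trans _ _ _ h k x := (h x).trans (k x)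
  le_antisymm _ _ h k := ext fun x => le_antisymm (h x) (k x)
  sup := sup
  inf := inf
  le_sup_left f g x := (le_sup_left : f x ≤ f x ⊔ g x)
  le_sup_right f g x := (le_sup_right : g x ≤ f x ⊔ g x)
  sup_le _ _ _ h k x := sup_le (h x) (k x)
  inf_le_left f g x := (inf_le_left : f x ⊓ g x ≤ f x)
  inf_le_right f g x := (inf_le_right : f x ⊓ g x ≤ g x)
  le_inf _ _ _ h k x := le_inf (h x) (k x)

theorem sup_apply (f g : ChainAut Ω) (x : Ω) : (f ⊔ g) x = f x ⊔ g x := rfl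

theorem inf_apply (f g : ChainAut Ω) (x : Ω) : (f ⊓ g) x = f x ⊓ g x := rfl

instance : MulLeftMono (ChainAut Ω) where
  elim f _ _ h x := h (f x)

instance : MulRightMono (ChainAut Ω) where
  elim f _ _ h x := f.mono (h x)

end ChainAut

/-! ## Right pre-orders and the right regular representation -/

/-- A right pre-order on the partially ordered group `G`, given by its positive cone: a proper
submonoid `C` of `G` with `G = C ∪ C⁻¹` and `G⁺ ⊆ C`. -/
structure PreCone (G : Type u) [Group G] [PartialOrder G] extends Submonoid G where
  proper' : carrier ≠ Set.univ
  total' : ∀ a : G, a ∈ carrier ∨ a⁻¹ ∈ carrier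
  pos_mem' : ∀ a : G, 1 ≤ a → a ∈ carrier

section PreCone

variable {G : Type u} [Group G] [PartialOrder G]

instance PreCone.instSetLike : SetLike (PreCone G) G where
  coe C := C.carrier
  coe_injective C D e := by
    obtain ⟨C, _, _, _⟩ := C
    obtain ⟨D, _, _, _⟩ := D
    have hCD : C = D := SetLike.coe_injective e
    subst hCD
    rfl

instance PreCone.instSubmonoidClass : SubmonoidClass (PreCone G) G where
  mul_mem {C} := C.toSubmonoid.mul_mem
  one_mem C := C.toSubmonoid.one_mem

namespace PreCone

variable (C : PreCone G)

/-- The relation `a ≼ b` on `G` with positive cone `C`. -/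
def Rel (a b : G) : Prop := b * a⁻¹ ∈ C

theorem rel_refl (a : G) : C.Rel a a := by
  unfold Rel
  rw [mul_inv_cancel]
  exact one_mem C

theorem rel_trans {a b c : G} (h : C.Rel a b) (k : C.Rel b c) : C.Rel a c := by
  have h' := mul_mem k h
  unfold Rel
  simpa [mul_assoc] using h'

theorem rel_total (a b : G) : C.Rel a b ∨ C.Rel b a := by
  have h := C.total' (b * a⁻¹)
  rw [mul_inv_rev, inv_inv] at h
  exact h

theorem rel_mul_right {a b : G} (t : G) (h : C.Rel a b) : C.Rel (a * t) (b * t) := by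
  unfold Rel at *
  simpa [mul_assoc] using h

theorem rel_mul_right_iff {a b : G} (t : G) : C.Rel (a * t) (b * t) ↔ C.Rel a b :=
  ⟨fun h => by simpa using C.rel_mul_right t⁻¹ h, C.rel_mul_right t⟩

/-- The right pre-order is a (two-sided) pre-order: it is also left invariant. -/
def IsPreorder : Prop := ∀ a b t : G, C.Rel a b → C.Rel (t * a) (t * b)

/-- The equivalence relation `a ≼ b` and `b ≼ a`. -/
def setoid : Setoid G where
  r a b := C.Rel a b ∧ C.Rel b a
  iseqv :=
    { refl := fun a => ⟨C.rel_refl a, C.rel_refl a⟩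
      symm := fun h => ⟨h.2, h.1⟩
      trans := fun h k => ⟨C.rel_trans h.1 k.1, C.rel_trans k.2 h.2⟩ }

/-- The chain of equivalence classes of the right pre-order. -/
def Omega : Type u := Quotient C.setoid

/-- The class of `a`. -/
def cls (a : G) : C.Omega := Quotient.mk C.setoid a

/-- The class of `a` is below the class of `b` if and only if `a ≼ b`. -/
noncomputable instance : LinearOrder C.Omega where
  le := Quotient.lift₂ (s₁ := C.setoid) (s₂ := C.setoid) C.Rel (fun _ _ _ _ h k =>
    propext ⟨fun e => C.rel_trans h.2 (C.rel_trans e k.1),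
      fun e => C.rel_trans h.1 (C.rel_trans e k.2)⟩)
  le_refl := by
    rintro ⟨a⟩
    exact C.rel_refl a
  le_trans := by
    rintro ⟨a⟩ ⟨b⟩ ⟨c⟩ h k
    exact C.rel_trans h k
  le_antisymm := by
    rintro ⟨a⟩ ⟨b⟩ h k
    exact Quotient.sound (s := C.setoid) ⟨h, k⟩
  le_total := by
    rintro ⟨a⟩ ⟨b⟩
    exact C.rel_total a b
  toDecidableLE := Classical.decRel _

theorem cls_le_cls (a b : G) : C.cls a ≤ C.cls b ↔ C.Rel a b := Iff.rfl

/-- The map on classes that sends the class of `b` to the class of `b * a`. -/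
def mulRight (a : G) : C.Omega → C.Omega :=
  Quotient.lift (s := C.setoid) (fun b => C.cls (b * a)) (fun _ _ h =>
    Quotient.sound (s := C.setoid) ⟨C.rel_mul_right a h.1, C.rel_mul_right a h.2⟩)

theorem mulRight_mul (a b : G) (x : C.Omega) :
    C.mulRight b (C.mulRight a x) = C.mulRight (a * b) x := by
  obtain ⟨c⟩ := x
  change C.cls (c * a * b) = C.cls (c * (a * b))
  rw [mul_assoc]

theorem mulRight_one (x : C.Omega) : C.mulRight 1 x = x := by
  obtain ⟨c⟩ := x
  change C.cls (c * 1) = C.cls c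
  rw [mul_one]

theorem mulRight_mono (a : G) : Monotone (C.mulRight a) := by
  rintro ⟨b⟩ ⟨c⟩ h
  exact C.rel_mul_right a h

/-- The automorphism of the chain of classes that sends the class of `b` to that of `b * a`. -/
noncomputable def rhoFun (a : G) : ChainAut C.Omega :=
  Equiv.toOrderIso
    { toFun := C.mulRight a
      invFun := C.mulRight a⁻¹
      left_inv := fun x => by rw [mulRight_mul, mul_inv_cancel, mulRight_one]
      right_inv := fun x => by rw [mulRight_mul, inv_mul_cancel, mulRight_one] }
    (C.mulRight_mono a) (C.mulRight_mono a⁻¹)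

/-- The homomorphism from `G` to the automorphisms of the chain of classes. -/
noncomputable def rho : G →* ChainAut C.Omega where
  toFun := C.rhoFun
  map_one' := ChainAut.ext fun x => C.mulRight_one x
  map_mul' a b := ChainAut.ext fun x => (C.mulRight_mul a b x).symm

theorem rho_apply (a b : G) : C.rho a (C.cls b) = C.cls (b * a) := rfl

/-- The `ℓ`-subgroup of the automorphisms of the chain of classes generated by the image
of `G`. -/
noncomputable def HSub : LSubgroup (ChainAut C.Omega) := LSubgroup.closure (Set.range C.rho)

variable [MulLeftMono G] [MulRightMono G]

theorem rho_mono : Monotone C.rho := by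
  rintro a b h ⟨c⟩
  apply C.pos_mem'
  have h1 : c * a ≤ c * b := mul_le_mul_right h c
  have h2 := mul_le_mul_left h1 (c * a)⁻¹
  rwa [mul_inv_cancel] at h2

/-- The right regular representation, as a positive homomorphism. -/
noncomputable def R : G →*o C.HSub where
  toFun a := ⟨C.rho a, LSubgroup.subset_closure _ ⟨a, rfl⟩⟩
  map_one' := Subtype.ext C.rho.map_one
  map_mul' a b := Subtype.ext (C.rho.map_mul a b)
  monotone' _ _ h := C.rho_mono h

end PreCone

/-- The space of right pre-orders `C` on `G` whose right regular representation has its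
`ℓ`-group `C.HSub` in the variety axiomatised by `E`. -/
def RightPreorders (E : Equations) (G : Type u) [Group G] [PartialOrder G] : Type u :=
  {C : PreCone G // InVariety E C.HSub}

/-- The set of right pre-orders in which `a` is strictly positive. -/
def RightPreorders.basicOpen (E : Equations) (a : G) : Set (RightPreorders E G) :=
  {C | a ∈ C.1 ∧ a⁻¹ ∉ C.1}

/-- The smallest topology in which all sets `basicOpen E a` are open. -/
instance (E : Equations) : TopologicalSpace (RightPreorders E G) :=
  TopologicalSpace.generateFrom (Set.range (RightPreorders.basicOpen E))

end PreCone

/-- The subset of (two-sided) pre-orders; as a type it carries the subspace topology. -/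
def Preorders (E : Equations) (G : Type u) [Group G] [PartialOrder G] :
    Set (RightPreorders E G) :=
  {C | C.1.IsPreorder}

/-! ## The spectrum of an `ℓ`-group -/

/-- A convex `ℓ`-subgroup. -/
structure ConvexLSubgroup (H : Type u) [Group H] [Lattice H] extends LSubgroup H where
  convex' : ∀ {x y z : H}, x ∈ carrier → y ∈ carrier → x ≤ z → z ≤ y → z ∈ carrier

section Spectrum

variable {H : Type u} [Group H] [Lattice H]

instance ConvexLSubgroup.instSetLike : SetLike (ConvexLSubgroup H) H where
  coe K := K.carrier
  coe_injective K L e := by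
    obtain ⟨K, _⟩ := K
    obtain ⟨L, _⟩ := L
    have hKL : K = L := SetLike.coe_injective e
    subst hKL
    rfl

instance ConvexLSubgroup.instSubgroupClass : SubgroupClass (ConvexLSubgroup H) H where
  mul_mem {K} := K.toSubgroup.mul_mem
  one_mem K := K.toSubgroup.one_mem
  inv_mem {K} := K.toSubgroup.inv_mem

/-- The set of right cosets `K x` of a convex `ℓ`-subgroup `K`. -/
def ConvexLSubgroup.Cosets (K : ConvexLSubgroup H) : Type u :=
  Quotient (QuotientGroup.rightRel K.toSubgroup)

/-- The right coset `K x`. -/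
def ConvexLSubgroup.coset (K : ConvexLSubgroup H) (x : H) : K.Cosets :=
  Quotient.mk (QuotientGroup.rightRel K.toSubgroup) x

/-- Two elements have the same coset if and only if they differ by a left factor from `K`. -/
theorem ConvexLSubgroup.coset_eq (K : ConvexLSubgroup H) (x y : H) :
    K.coset x = K.coset y ↔ y * x⁻¹ ∈ K :=
  (Quotient.eq (r := QuotientGroup.rightRel K.toSubgroup)).trans QuotientGroup.rightRel_apply

theorem ConvexLSubgroup.le_aux [MulLeftMono H] (K : ConvexLSubgroup H) {x y x' y' : H} (hx : x' * x⁻¹ ∈ K)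
    (hy : y' * y⁻¹ ∈ K) (h : ∃ t ∈ K, x ≤ t * y) : ∃ t ∈ K, x' ≤ t * y' := by
  obtain ⟨t, ht, hle⟩ := h
  refine ⟨x' * x⁻¹ * t * (y' * y⁻¹)⁻¹, mul_mem (mul_mem hx ht) (inv_mem hy), ?_⟩
  have h1 := mul_le_mul_right hle (x' * x⁻¹)
  simpa [mul_assoc] using h1

variable [MulLeftMono H]

/-- The order on right cosets: `K x ≤ K y` if and only if `x ≤ t y` for some `t ∈ K`. -/
instance (K : ConvexLSubgroup H) : LE K.Cosets where
  le := Quotient.lift₂ (s₁ := QuotientGroup.rightRel K.toSubgroup)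
    (s₂ := QuotientGroup.rightRel K.toSubgroup) (fun x y => ∃ t ∈ K, x ≤ t * y)
    (fun _ _ _ _ h k => by
      have h1 := QuotientGroup.rightRel_apply.1 h
      have k1 := QuotientGroup.rightRel_apply.1 k
      have h2 := QuotientGroup.rightRel_apply.1 (Setoid.symm' _ h)
      have k2 := QuotientGroup.rightRel_apply.1 (Setoid.symm' _ k)
      exact propext ⟨K.le_aux h1 k1, K.le_aux h2 k2⟩)

theorem ConvexLSubgroup.coset_le_coset (K : ConvexLSubgroup H) (x y : H) :
    K.coset x ≤ K.coset y ↔ ∃ t ∈ K, x ≤ t * y := Iff.rfl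

/-- A convex `ℓ`-subgroup is prime if it is proper and its cosets are totally ordered. -/
def ConvexLSubgroup.IsPrime (K : ConvexLSubgroup H) : Prop :=
  (K : Set H) ≠ Set.univ ∧ ∀ X Y : K.Cosets, X ≤ Y ∨ Y ≤ X

variable [MulRightMono H]

variable (H) in
/-- The set of prime subgroups of `H`. -/
def Spec : Type u := {K : ConvexLSubgroup H // K.IsPrime}

/-- The set of prime subgroups that do not include `A`. -/
def Spec.support (A : Set H) : Set (Spec H) := {p | ¬ A ⊆ (p.1 : Set H)}

theorem ConvexLSubgroup.mabs_mem_iff (K : ConvexLSubgroup H) (a : H) : |a|ₘ ∈ K ↔ a ∈ K := by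
  constructor
  · intro h
    exact K.convex' (inv_mem h) h (inv_le_of_inv_le' (inv_le_mabs a)) (le_mabs_self a)
  · intro h
    exact K.sup_mem' h (inv_mem h)

theorem ConvexLSubgroup.IsPrime.mem_of_inf {K : ConvexLSubgroup H} (hK : K.IsPrime) {a b : H}
    (h : |a|ₘ ⊓ |b|ₘ ∈ K) : a ∈ K ∨ b ∈ K := by
  have key : ∀ c d : H, |c|ₘ ⊓ |d|ₘ ∈ K → K.coset |c|ₘ ≤ K.coset |d|ₘ → c ∈ K := by
    rintro c d hm ⟨t, ht, hle⟩
    have hT : |t|ₘ ∈ K := (K.mabs_mem_iff t).2 ht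
    have h1 : |c|ₘ ≤ |t|ₘ * (|c|ₘ ⊓ |d|ₘ) := by
      rw [mul_inf]
      refine le_inf ?_ (hle.trans (mul_le_mul_left (le_mabs_self t) _))
      have := mul_le_mul_left (one_le_mabs t) |c|ₘ
      rwa [one_mul] at this
    exact (K.mabs_mem_iff c).1 (K.convex' (one_mem K) (mul_mem hT hm) (one_le_mabs c) h1)
  rcases hK.2 (K.coset |a|ₘ) (K.coset |b|ₘ) with h1 | h1
  · exact Or.inl (key a b h h1)
  · exact Or.inr (key b a (by rwa [inf_comm]) h1)

/-- The spectral topology: the open sets are exactly the sets `Spec.support A`. -/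
instance : TopologicalSpace (Spec H) where
  IsOpen U := ∃ A : Set H, U = Spec.support A
  isOpen_univ := by
    refine ⟨Set.univ, ?_⟩
    ext p
    simpa [Spec.support, Set.univ_subset_iff] using p.2.1
  isOpen_inter := by
    rintro _ _ ⟨A, rfl⟩ ⟨B, rfl⟩
    refine ⟨{x | ∃ a ∈ A, ∃ b ∈ B, x = |a|ₘ ⊓ |b|ₘ}, ?_⟩
    ext p
    constructor
    · rintro ⟨h1, h2⟩
      obtain ⟨a, ha, ha'⟩ := Set.not_subset.1 h1
      obtain ⟨b, hb, hb'⟩ := Set.not_subset.1 h2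
      refine Set.not_subset.2 ⟨_, ⟨a, ha, b, hb, rfl⟩, fun hm => ?_⟩
      rcases p.2.mem_of_inf hm with h | h
      · exact ha' h
      · exact hb' h
    · intro hp
      obtain ⟨_, ⟨a, ha, b, hb, rfl⟩, hm⟩ := Set.not_subset.1 hp
      have h1 : (1 : H) ≤ |a|ₘ ⊓ |b|ₘ := le_inf (one_le_mabs a) (one_le_mabs b)
      refine ⟨Set.not_subset.2 ⟨a, ha, fun h => hm ?_⟩,
        Set.not_subset.2 ⟨b, hb, fun h => hm ?_⟩⟩
      · exact p.1.convex' (one_mem p.1) ((p.1.mabs_mem_iff a).2 h) h1 inf_le_left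
      · exact p.1.convex' (one_mem p.1) ((p.1.mabs_mem_iff b).2 h) h1 inf_le_right
  isOpen_sUnion := by
    intro S hS
    refine ⟨{x | ∃ A : Set H, Spec.support A ∈ S ∧ x ∈ A}, ?_⟩
    ext p
    constructor
    · rintro ⟨U, hU, hp⟩
      obtain ⟨A, rfl⟩ := hS U hU
      obtain ⟨x, hx, hx'⟩ := Set.not_subset.1 hp
      exact Set.not_subset.2 ⟨x, ⟨A, hU, hx⟩, hx'⟩
    · intro hp
      obtain ⟨x, ⟨A, hA, hx⟩, hx'⟩ := Set.not_subset.1 hp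
      exact ⟨_, hA, Set.not_subset.2 ⟨x, hx, hx'⟩⟩

variable (H) in
/-- The subset of prime ideals, that is, of normal prime subgroups; as a type it carries the
subspace topology. -/
def SpecStar : Set (Spec H) := {p | p.1.toSubgroup.Normal}

end Spectrum

/-! ## The free `ℓ`-group over a partially ordered group in a variety -/

section Free

variable {G : Type u} [Group G] [PartialOrder G]

/-- The congruence on terms over `G` generated by the axioms of `ℓ`-groups, by all instances of
the equations in `E`, and by the products and the order relations that hold in `G`. -/
inductive FreeRel (E : Equations) : LTerm G → LTerm G → Prop
  | refl (s) : FreeRel E s s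
  | symm {s t} : FreeRel E s t → FreeRel E t s
  | trans {s t r} : FreeRel E s t → FreeRel E t r → FreeRel E s r
  | mul_congr {s s' t t'} : FreeRel E s s' → FreeRel E t t' → FreeRel E (.mul s t) (.mul s' t')
  | inv_congr {s s'} : FreeRel E s s' → FreeRel E (.inv s) (.inv s')
  | sup_congr {s s' t t'} : FreeRel E s s' → FreeRel E t t' → FreeRel E (.sup s t) (.sup s' t')
  | inf_congr {s s' t t'} : FreeRel E s s' → FreeRel E t t' → FreeRel E (.inf s t) (.inf s' t')
  | mul_assoc (s t r) : FreeRel E (.mul (.mul s t) r) (.mul s (.mul t r))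
  | one_mul (s) : FreeRel E (.mul .one s) s
  | mul_one (s) : FreeRel E (.mul s .one) s
  | inv_mul (s) : FreeRel E (.mul (.inv s) s) .one
  | sup_comm (s t) : FreeRel E (.sup s t) (.sup t s)
  | sup_assoc (s t r) : FreeRel E (.sup (.sup s t) r) (.sup s (.sup t r))
  | inf_comm (s t) : FreeRel E (.inf s t) (.inf t s)
  | inf_assoc (s t r) : FreeRel E (.inf (.inf s t) r) (.inf s (.inf t r))
  | sup_inf_self (s t) : FreeRel E (.sup s (.inf s t)) s
  | inf_sup_self (s t) : FreeRel E (.inf s (.sup s t)) s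
  | mul_sup (s t r) : FreeRel E (.mul s (.sup t r)) (.sup (.mul s t) (.mul s r))
  | sup_mul (s t r) : FreeRel E (.mul (.sup s t) r) (.sup (.mul s r) (.mul t r))
  | equation (e) (he : e ∈ E) (σ : ℕ → LTerm G) : FreeRel E (e.1.subst σ) (e.2.subst σ)
  | var_mul (a b : G) : FreeRel E (.var (a * b)) (.mul (.var a) (.var b))
  | var_le (a b : G) (h : a ≤ b) : FreeRel E (.sup (.var a) (.var b)) (.var b)

/-- The congruence as a setoid. -/
def FreeRel.setoid (E : Equations) (G : Type u) [Group G] [PartialOrder G] :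
    Setoid (LTerm G) where
  r := FreeRel E
  iseqv := ⟨.refl, .symm, .trans⟩

/-- The `ℓ`-group freely generated by the partially ordered group `G` in the variety axiomatised
by `E`. -/
def FreeLGroup (E : Equations) (G : Type u) [Group G] [PartialOrder G] : Type u :=
  Quotient (FreeRel.setoid E G)

namespace FreeLGroup

variable {E : Equations}

/-- The class of a term. -/
def mk (E : Equations) (s : LTerm G) : FreeLGroup E G := Quotient.mk (FreeRel.setoid E G) s

theorem sound {s t : LTerm G} (h : FreeRel E s t) : mk E s = mk E t :=
  Quotient.sound (s := FreeRel.setoid E G) h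

instance : Mul (FreeLGroup E G) where
  mul := Quotient.map₂ (sa := FreeRel.setoid E G) (sb := FreeRel.setoid E G)
    (sc := FreeRel.setoid E G) LTerm.mul (fun _ _ h _ _ k => FreeRel.mul_congr h k)

instance : Max (FreeLGroup E G) where
  max := Quotient.map₂ (sa := FreeRel.setoid E G) (sb := FreeRel.setoid E G)
    (sc := FreeRel.setoid E G) LTerm.sup (fun _ _ h _ _ k => FreeRel.sup_congr h k)

instance : Min (FreeLGroup E G) where
  min := Quotient.map₂ (sa := FreeRel.setoid E G) (sb := FreeRel.setoid E G)
    (sc := FreeRel.setoid E G) LTerm.inf (fun _ _ h _ _ k => FreeRel.inf_congr h k)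

instance : Inv (FreeLGroup E G) where
  inv := Quotient.map (sa := FreeRel.setoid E G) (sb := FreeRel.setoid E G) LTerm.inv
    (fun _ _ h => FreeRel.inv_congr h)

instance : One (FreeLGroup E G) where
  one := mk E .one

instance : Group (FreeLGroup E G) where
  mul_assoc := by
    rintro ⟨s⟩ ⟨t⟩ ⟨r⟩
    exact sound (.mul_assoc s t r)
  one_mul := by
    rintro ⟨s⟩
    exact sound (.one_mul s)
  mul_one := by
    rintro ⟨s⟩
    exact sound (.mul_one s)
  inv_mul_cancel := by
    rintro ⟨s⟩
    exact sound (.inv_mul s)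

/-- Auxiliary form of the lattice structure below. -/
@[reducible]
def latticeAux (E : Equations) (G : Type u) [Group G] [PartialOrder G] :
    Lattice (FreeLGroup E G) :=
  Lattice.mk'
    (by rintro ⟨s⟩ ⟨t⟩; exact sound (.sup_comm s t))
    (by rintro ⟨s⟩ ⟨t⟩ ⟨r⟩; exact sound (.sup_assoc s t r))
    (by rintro ⟨s⟩ ⟨t⟩; exact sound (.inf_comm s t))
    (by rintro ⟨s⟩ ⟨t⟩ ⟨r⟩; exact sound (.inf_assoc s t r))
    (by rintro ⟨s⟩ ⟨t⟩; exact sound (.sup_inf_self s t))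
    (by rintro ⟨s⟩ ⟨t⟩; exact sound (.inf_sup_self s t))

/-- The lattice structure of the free `ℓ`-group; `x ≤ y` means `x ⊔ y = y`. -/
instance : Lattice (FreeLGroup E G) where
  le x y := x ⊔ y = y
  le_refl := (latticeAux E G).le_refl
  le_trans := (latticeAux E G).le_trans
  le_antisymm := (latticeAux E G).le_antisymm
  sup x y := x ⊔ y
  inf x y := x ⊓ y
  le_sup_left := (latticeAux E G).le_sup_left
  le_sup_right := (latticeAux E G).le_sup_right
  sup_le := (latticeAux E G).sup_le
  inf_le_left := (latticeAux E G).inf_le_left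
  inf_le_right := (latticeAux E G).inf_le_right
  le_inf := (latticeAux E G).le_inf

instance : MulLeftMono (FreeLGroup E G) where
  elim := by
    rintro ⟨s⟩ ⟨t⟩ ⟨r⟩ h
    change mk E s * mk E t ≤ mk E s * mk E r
    have h' : mk E t ⊔ mk E r = mk E r := sup_eq_right.2 h
    have e : mk E s * (mk E t ⊔ mk E r) = mk E s * mk E t ⊔ mk E s * mk E r :=
      sound (.mul_sup s t r)
    rw [h'] at e
    exact sup_eq_right.1 e.symm

instance : MulRightMono (FreeLGroup E G) where
  elim := by
    rintro ⟨s⟩ ⟨t⟩ ⟨r⟩ h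
    change mk E t * mk E s ≤ mk E r * mk E s
    have h' : mk E t ⊔ mk E r = mk E r := sup_eq_right.2 h
    have e : (mk E t ⊔ mk E r) * mk E s = mk E t * mk E s ⊔ mk E r * mk E s :=
      sound (.sup_mul t r s)
    rw [h'] at e
    exact sup_eq_right.1 e.symm

/-- The universal positive homomorphism from `G` to the free `ℓ`-group. -/
def eta (E : Equations) (G : Type u) [Group G] [PartialOrder G] : G →*o FreeLGroup E G where
  toFun a := mk E (.var a)
  map_one' := by
    have h : mk E (.var (1 : G)) * mk E (.var 1) = mk E (.var 1) := by
      have h1 : mk E (.var ((1 : G) * 1)) = mk E (.var 1) * mk E (.var 1) := sound (.var_mul 1 1)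
      rw [mul_one] at h1
      exact h1.symm
    exact mul_eq_left.1 h
  map_mul' a b := sound (.var_mul a b)
  monotone' a b h := by
    change mk E (.var a) ≤ mk E (.var b)
    have e : mk E (.var a) ⊔ mk E (.var b) = mk E (.var b) := sound (.var_le a b h)
    exact sup_eq_right.1 e

theorem eval_mk {X : Type v} (σ : X → LTerm G) (s : LTerm X) :
    s.eval (fun x => mk E (σ x)) = mk E (s.subst σ) := by
  induction s with
  | var x => rfl
  | one => rfl
  | mul s t hs ht => simp only [LTerm.eval, hs, ht]; rfl
  | inv s hs => simp only [LTerm.eval, hs]; rfl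
  | sup s t hs ht => simp only [LTerm.eval, hs, ht]; rfl
  | inf s t hs ht => simp only [LTerm.eval, hs, ht]; rfl

/-- The free `ℓ`-group belongs to the variety. -/
theorem inVariety (E : Equations) (G : Type u) [Group G] [PartialOrder G] :
    InVariety E (FreeLGroup E G) := by
  intro e he f
  choose σ hσ using fun n => Quotient.exists_rep (f n)
  have hf : f = fun n => mk E (σ n) := funext fun n => (hσ n).symm
  rw [hf, eval_mk, eval_mk]
  exact sound (.equation e he σ)

section Lift

variable {H : Type v} [Group H] [Lattice H]

theorem eval_subst {X : Type u} {Y : Type*} (f : Y → H) (σ : X → LTerm Y) (s : LTerm X) :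
    (s.subst σ).eval f = s.eval (fun x => (σ x).eval f) := by
  induction s with
  | var x => rfl
  | one => rfl
  | mul s t hs ht => simp only [LTerm.eval, LTerm.subst, hs, ht]
  | inv s hs => simp only [LTerm.eval, LTerm.subst, hs]
  | sup s t hs ht => simp only [LTerm.eval, LTerm.subst, hs, ht]
  | inf s t hs ht => simp only [LTerm.eval, LTerm.subst, hs, ht]

variable [MulLeftMono H] [MulRightMono H]

theorem eval_eq_of_rel (hH : InVariety E H) (p : G →*o H) {s t : LTerm G} (h : FreeRel E s t) :
    s.eval p = t.eval p := by
  induction h with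
  | refl => rfl
  | symm _ h => exact h.symm
  | trans _ _ h k => exact h.trans k
  | mul_congr _ _ h k => simp only [LTerm.eval, h, k]
  | inv_congr _ h => simp only [LTerm.eval, h]
  | sup_congr _ _ h k => simp only [LTerm.eval, h, k]
  | inf_congr _ _ h k => simp only [LTerm.eval, h, k]
  | mul_assoc => exact _root_.mul_assoc _ _ _
  | one_mul => exact _root_.one_mul _
  | mul_one => exact _root_.mul_one _
  | inv_mul => exact inv_mul_cancel _
  | sup_comm => exact _root_.sup_comm _ _
  | sup_assoc => exact _root_.sup_assoc _ _ _
  | inf_comm => exact _root_.inf_comm _ _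
  | inf_assoc => exact _root_.inf_assoc _ _ _
  | sup_inf_self => exact _root_.sup_inf_self
  | inf_sup_self => exact _root_.inf_sup_self
  | mul_sup => exact _root_.mul_sup _ _ _
  | sup_mul => exact _root_.sup_mul _ _ _
  | equation e he σ =>
    rw [eval_subst, eval_subst]
    exact hH e he _
  | var_mul a b => exact map_mul p a b
  | var_le a b h => exact sup_eq_right.2 (OrderHomClass.mono p h)

/-- The `ℓ`-homomorphism out of the free `ℓ`-group induced by a positive homomorphism `p` from
`G` to an `ℓ`-group in the variety. -/
def lift (hH : InVariety E H) (p : G →*o H) : LHom (FreeLGroup E G) H where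
  toFun := Quotient.lift (s := FreeRel.setoid E G) (LTerm.eval p)
    (fun _ _ h => eval_eq_of_rel hH p h)
  map_one' := rfl
  map_mul' := by
    rintro ⟨s⟩ ⟨t⟩
    rfl
  map_sup' := by
    rintro ⟨s⟩ ⟨t⟩
    rfl
  map_inf' := by
    rintro ⟨s⟩ ⟨t⟩
    rfl

/-- The universal property of the free `ℓ`-group. -/
theorem lift_unique (hH : InVariety E H) (p : G →*o H) (h : LHom (FreeLGroup E G) H) :
    (∀ a : G, h (eta E G a) = p a) ↔ h = lift hH p := by
  constructor
  · intro hp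
    apply DFunLike.ext
    rintro ⟨s⟩
    change h (mk E s) = s.eval p
    induction s with
    | var a => exact hp a
    | one => exact h.map_one'
    | mul s t hs ht => exact (h.map_mul' (mk E s) (mk E t)).trans (congrArg₂ _ hs ht)
    | inv s hs => exact (h.toMonoidHom.map_inv (mk E s)).trans (congrArg _ hs)
    | sup s t hs ht => exact (h.map_sup' (mk E s) (mk E t)).trans (congrArg₂ _ hs ht)
    | inf s t hs ht => exact (h.map_inf' (mk E s) (mk E t)).trans (congrArg₂ _ hs ht)
  · rintro rfl a
    rfl

end Lift

end FreeLGroup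

end Free

/-! ## The two correspondences -/

section Maps

variable {G : Type u} [Group G] [PartialOrder G] [MulLeftMono G] [MulRightMono G]

/-- The `ℓ`-homomorphism from the free `ℓ`-group to `C.HSub` that extends the right regular
representation of `C`. -/
noncomputable def RightPreorders.hom {E : Equations} (C : RightPreorders E G) :
    LHom (FreeLGroup E G) C.1.HSub :=
  FreeLGroup.lift C.2 C.1.R

/-- The underlying set of `κ(C)`: the preimage of the stabiliser of the class of the identity. -/
def kappaSet {E : Equations} (C : RightPreorders E G) : Set (FreeLGroup E G) :=
  {x | (C.hom x : ChainAut C.1.Omega) (C.1.cls 1) = C.1.cls 1}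

/-- The relation `p η(a) ≤ p η(b)` on `G`. -/
def piRel {E : Equations} (p : Spec (FreeLGroup E G)) (a b : G) : Prop :=
  p.1.coset (FreeLGroup.eta E G a) ≤ p.1.coset (FreeLGroup.eta E G b)

/-- The underlying set of `π(p)`: the positive cone of the relation `piRel p`. -/
def piSet {E : Equations} (p : Spec (FreeLGroup E G)) : Set G := {a | piRel p 1 a}

end Maps

end LGrp

open LGrp

/-!
The image of `G` generates the free `ℓ`-group as a lattice, so a lattice homomorphism from it is
determined by its values on `G`, and one to a chain already attains all its values on `G`. An
action of the free `ℓ`-group on a chain makes the orbit map of a point such a homomorphism. Hence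
the right cosets of a prime subgroup `p` are the orbit of `p` under `G`, that is, the chain of
classes of `π(p)`, and the orbit map of the class of the identity under a right pre-order `C` is
the projection to the cosets of `κ(C)`. Mutual inverseness, monotonicity, the passage to two-sided
pre-orders and continuity all follow by comparing lattice homomorphisms on `G`; in the last case
one uses that `sup` and `inf` of a chain turn the condition of being strictly above the base point
into unions and intersections of open sets.
-/

namespace LGrp

section LHom

variable {H K L : Type*} [Group H] [Lattice H] [Group K] [Lattice K] [Group L] [Lattice L]

instance LHom.instMonoidHomClass : MonoidHomClass (LHom H K) H K where
  map_mul f := f.map_mul'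
  map_one f := f.map_one'

instance LHom.instLatticeHomClass : LatticeHomClass (LHom H K) H K where
  map_sup f := f.map_sup'
  map_inf f := f.map_inf'

/-- The composite of two `ℓ`-homomorphisms. -/
def LHom.comp (g : LHom K L) (f : LHom H K) : LHom H L where
  toMonoidHom := g.toMonoidHom.comp f.toMonoidHom
  map_sup' x y := (congrArg g (map_sup f x y)).trans (map_sup g _ _)
  map_inf' x y := (congrArg g (map_inf f x y)).trans (map_inf g _ _)

/-- The image of an `ℓ`-homomorphism. -/
def LHom.range (f : LHom H K) : LSubgroup K where
  toSubgroup := f.toMonoidHom.range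
  sup_mem' := by
    rintro _ _ ⟨x, rfl⟩ ⟨y, rfl⟩
    exact ⟨x ⊔ y, map_sup f x y⟩
  inf_mem' := by
    rintro _ _ ⟨x, rfl⟩ ⟨y, rfl⟩
    exact ⟨x ⊓ y, map_inf f x y⟩

/-- An `ℓ`-homomorphism as a positive homomorphism of partially ordered groups. -/
def LHom.toOrderMonoidHom (f : LHom H K) : H →*o K where
  toMonoidHom := f.toMonoidHom
  monotone' := OrderHomClass.mono f

/-- The inclusion of an `ℓ`-subgroup. -/
def LSubgroup.subtype (S : LSubgroup H) : LHom S H where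
  toMonoidHom := S.toSubgroup.subtype
  map_sup' _ _ := rfl
  map_inf' _ _ := rfl

theorem LHom.map_eval (f : LHom H K) {X : Type*} (v : X → H) (s : LTerm X) :
    f (s.eval v) = s.eval (f ∘ v) := by
  induction s with
  | var x => rfl
  | one => exact map_one f
  | mul s t hs ht => simp only [LTerm.eval, map_mul, hs, ht]
  | inv s hs => simp only [LTerm.eval, map_inv, hs]
  | sup s t hs ht => simp only [LTerm.eval, map_sup, hs, ht]
  | inf s t hs ht => simp only [LTerm.eval, map_inf, hs, ht]

theorem InVariety.of_le_range {E : Equations} (hH : InVariety E H) (f : LHom H K)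
    {S : LSubgroup K} (hS : (S : Set K) ⊆ f.range) : InVariety E S := by
  intro e he v
  choose w hw using fun n => hS (v n).2
  have eval_coe (s : LTerm ℕ) : ((s.eval v : S) : K) = f (s.eval w) := by
    rw [f.map_eval, show f ∘ w = S.subtype ∘ v from funext hw]
    exact S.subtype.map_eval v s
  exact Subtype.ext (by rw [eval_coe, eval_coe, hH e he w])

end LHom

section LatticeGeneration

theorem image_latticeClosure_of_linearOrder {L Ω : Type*} [Lattice L] [LinearOrder Ω]
    (f : LatticeHom L Ω) (s : Set L) : f '' latticeClosure s = f '' s := by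
  rw [image_latticeClosure s f (map_sup f) (map_inf f),
    (LinearOrder.isSublattice (f '' s)).latticeClosure_eq]

theorem latticeHom_eqOn_latticeClosure {L M : Type*} [Lattice L] [Lattice M]
    {f g : LatticeHom L M} {s : Set L} (h : Set.EqOn f g s) : Set.EqOn f g (latticeClosure s) :=
  latticeClosure_min (t := {x | f x = g x}) h
    ⟨fun x hx y hy => by simp_all, fun x hx y hy => by simp_all⟩

variable {H : Type*} [Group H] [Lattice H] [MulLeftMono H] [MulRightMono H]

/-- The sublattice generated by a subgroup of an `ℓ`-group, which is again a subgroup. -/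
def LSubgroup.latticeClosure (S : Subgroup H) : LSubgroup H where
  carrier := _root_.latticeClosure S
  one_mem' := subset_latticeClosure S.one_mem
  mul_mem' {x y} hx hy := by
    have mul_left_mem {s : H} (hs : s ∈ S) :
        (fun z => s * z) '' _root_.latticeClosure S ⊆ _root_.latticeClosure S := by
      rw [image_latticeClosure _ _ (fun a b => mul_sup a b s) (fun a b => mul_inf a b s)]
      exact latticeClosure_mono (Set.image_subset_iff.2 fun _ => S.mul_mem hs)
    have mul_right_mem : (fun z => z * y) '' _root_.latticeClosure S ⊆ _root_.latticeClosure S := by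
      rw [image_latticeClosure _ _ (fun a b => sup_mul a b y) (fun a b => inf_mul a b y)]
      exact latticeClosure_min
        (Set.image_subset_iff.2 fun s hs => mul_left_mem hs (Set.mem_image_of_mem _ hy))
        isSublattice_latticeClosure
    exact mul_right_mem (Set.mem_image_of_mem _ hx)
  inv_mem' {x} hx := by
    have inv_mem : Inv.inv '' _root_.latticeClosure (S : Set H) ⊆ _root_.latticeClosure S := by
      rw [image_latticeClosure' _ _ inv_sup inv_inf]
      exact latticeClosure_mono (Set.image_subset_iff.2 fun _ => S.inv_mem)
    exact inv_mem (Set.mem_image_of_mem _ hx)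
  sup_mem' hx hy := isSublattice_latticeClosure.supClosed hx hy
  inf_mem' hx hy := isSublattice_latticeClosure.infClosed hx hy

end LatticeGeneration

namespace FreeLGroup

variable {G : Type*} [Group G] [PartialOrder G] {E : Equations}

theorem mem_of_eta_mem (S : LSubgroup (FreeLGroup E G)) (hS : ∀ a, eta E G a ∈ S)
    (x : FreeLGroup E G) : x ∈ S := by
  obtain ⟨s⟩ := x
  change mk E s ∈ S
  induction s with
  | var a => exact hS a
  | one => exact one_mem S
  | mul s t hs ht => exact mul_mem hs ht
  | inv s hs => exact inv_mem hs
  | sup s t hs ht => exact S.sup_mem' hs ht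
  | inf s t hs ht => exact S.inf_mem' hs ht

theorem mem_latticeClosure_range_eta (x : FreeLGroup E G) :
    x ∈ latticeClosure (Set.range (eta E G)) :=
  mem_of_eta_mem (.latticeClosure (eta E G).toMonoidHom.range)
    (fun a => subset_latticeClosure ⟨a, rfl⟩) x

theorem latticeHom_ext {L : Type*} [Lattice L] {f g : LatticeHom (FreeLGroup E G) L}
    (h : ∀ a, f (eta E G a) = g (eta E G a)) : f = g :=
  DFunLike.ext f g fun x => latticeHom_eqOn_latticeClosure (Set.forall_mem_range.2 h)
    (mem_latticeClosure_range_eta x)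

theorem exists_apply_eta_eq {Ω : Type*} [LinearOrder Ω] (f : LatticeHom (FreeLGroup E G) Ω)
    (x : FreeLGroup E G) : ∃ a, f (eta E G a) = f x := by
  have h := Set.mem_image_of_mem f (mem_latticeClosure_range_eta x)
  rwa [image_latticeClosure_of_linearOrder, ← Set.range_comp] at h

end FreeLGroup

section Action

variable {Ω Ω' : Type*} [LinearOrder Ω] [LinearOrder Ω']

theorem ChainAut.le_inv_apply_iff (f : ChainAut Ω) {x y : Ω} : x ≤ f⁻¹ y ↔ f x ≤ y :=
  OrderIso.le_symm_apply f

/-- Transport of automorphisms along an isomorphism of chains. -/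
def ChainAut.congr (e : Ω ≃o Ω') : LHom (ChainAut Ω) (ChainAut Ω') where
  toFun f := (e.symm.trans f).trans e
  map_one' := ext e.apply_symm_apply
  map_mul' _ g := ext fun _ => (congrArg (fun y => e (g y)) (e.symm_apply_apply _)).symm
  map_sup' _ _ := ext fun _ => e.map_sup _ _
  map_inf' _ _ := ext fun _ => e.map_inf _ _

variable {H : Type*} [Group H] [Lattice H] (φ : LHom H (ChainAut Ω)) (ω : Ω)

/-- The orbit map of a point of a chain on which an `ℓ`-group acts. -/
def LHom.orbit : LatticeHom H Ω where
  toFun x := φ x ω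
  map_sup' x y := by rw [map_sup, ChainAut.sup_apply]
  map_inf' x y := by rw [map_inf, ChainAut.inf_apply]

theorem LHom.orbit_apply (x : H) : φ.orbit ω x = φ x ω := rfl

theorem LHom.orbit_one : φ.orbit ω 1 = ω := by
  rw [orbit_apply, map_one, ChainAut.one_apply]

theorem LHom.orbit_mul (x y : H) : φ.orbit ω (x * y) = φ y (φ.orbit ω x) := by
  rw [orbit_apply, map_mul, ChainAut.mul_apply, orbit_apply]

/-- The stabiliser of a point of a chain on which an `ℓ`-group acts. -/
def LHom.stabilizer : ConvexLSubgroup H where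
  carrier := {x | φ.orbit ω x = ω}
  mul_mem' {x y} hx hy := by
    rw [Set.mem_ofPred_eq, orbit_mul, hx]
    exact hy
  one_mem' := φ.orbit_one ω
  inv_mem' {x} hx := by
    have h := φ.orbit_mul ω x x⁻¹
    rw [mul_inv_cancel, orbit_one, hx] at h
    exact h.symm
  sup_mem' {x y} hx hy := by
    rw [Set.mem_ofPred_eq, map_sup, hx, hy, sup_idem]
  inf_mem' {x y} hx hy := by
    rw [Set.mem_ofPred_eq, map_inf, hx, hy, inf_idem]
  convex' {x y z} hx hy hxz hzy :=
    le_antisymm ((OrderHomClass.mono (φ.orbit ω) hzy).trans_eq hy)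
      (hx.symm.trans_le (OrderHomClass.mono (φ.orbit ω) hxz))

theorem LHom.mem_stabilizer {x : H} : x ∈ φ.stabilizer ω ↔ φ.orbit ω x = ω := Iff.rfl

theorem LHom.stabilizer_normal (h : ∀ x ∈ φ.stabilizer ω, φ x = 1) :
    (φ.stabilizer ω).toSubgroup.Normal where
  conj_mem x hx y := by
    change φ (y * x * y⁻¹) ω = ω
    rw [map_mul, map_mul, h x hx, mul_one, ← map_mul, mul_inv_cancel, map_one, ChainAut.one_apply]

variable [MulLeftMono H] [MulRightMono H]

theorem LHom.stabilizer_coset_le_coset {x y : H} :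
    (φ.stabilizer ω).coset x ≤ (φ.stabilizer ω).coset y ↔ φ.orbit ω x ≤ φ.orbit ω y := by
  constructor
  · rintro ⟨t, ht, h⟩
    have h' := OrderHomClass.mono (φ.orbit ω) h
    rwa [orbit_mul, (φ.mem_stabilizer ω).1 ht] at h'
  · intro h
    refine ⟨x * y⁻¹ ⊔ 1, ?_, ?_⟩
    · rw [mem_stabilizer, map_sup, orbit_one, sup_eq_right, orbit_mul, map_inv]
      simpa only [orbit_apply, ChainAut.inv_apply_self] using (φ y)⁻¹.mono h
    · rw [sup_mul, inv_mul_cancel_right]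
      exact le_sup_left

theorem LHom.stabilizer_isPrime {x : H} (hx : φ.orbit ω x ≠ ω) : (φ.stabilizer ω).IsPrime := by
  refine ⟨fun h => hx ((φ.mem_stabilizer ω).1 (h ▸ Set.mem_univ x :)), ?_⟩
  rintro ⟨x⟩ ⟨y⟩
  exact (le_total (φ.orbit ω x) (φ.orbit ω y)).imp (φ.stabilizer_coset_le_coset ω).2
    (φ.stabilizer_coset_le_coset ω).2

end Action

section Cosets

variable {H : Type*} [Group H] [Lattice H]

namespace ConvexLSubgroup

variable (K : ConvexLSubgroup H)

theorem coset_surjective : Function.Surjective K.coset := Quotient.mk_surjective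

theorem coset_eq_coset_one {x : H} : K.coset x = K.coset 1 ↔ x ∈ K := by
  rw [coset_eq, one_mul, inv_mem_iff]

variable [MulLeftMono H]

theorem coset_mul_left_le [K.toSubgroup.Normal] {x y : H} (z : H)
    (h : K.coset x ≤ K.coset y) : K.coset (z * x) ≤ K.coset (z * y) := by
  obtain ⟨t, ht, h⟩ := h
  refine ⟨z * t * z⁻¹, ‹K.toSubgroup.Normal›.conj_mem t ht z, ?_⟩
  calc z * x ≤ z * (t * y) := mul_le_mul_right h z
    _ = z * t * z⁻¹ * (z * y) := by group

variable [MulRightMono H]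

instance : PartialOrder K.Cosets where
  le_refl := by
    rintro ⟨x⟩
    exact ⟨1, one_mem K, (one_mul x).ge⟩
  le_trans := by
    rintro ⟨x⟩ ⟨y⟩ ⟨z⟩ ⟨s, hs, hxy⟩ ⟨t, ht, hyz⟩
    refine ⟨s * t, mul_mem hs ht, hxy.trans ?_⟩
    rw [mul_assoc]
    exact mul_le_mul_right hyz s
  le_antisymm := by
    rintro ⟨x⟩ ⟨y⟩ ⟨s, hs, hxy⟩ ⟨t, ht, hyx⟩
    refine (K.coset_eq x y).2 (K.convex' (inv_mem hs) ht ?_ (mul_inv_le_iff_le_mul.2 hyx))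
    rwa [le_mul_inv_iff_mul_le, inv_mul_le_iff_le_mul]

theorem coset_mono : Monotone K.coset :=
  fun _ y h => ⟨1, one_mem K, h.trans_eq (one_mul y).symm⟩

theorem isLUB_coset_sup (x y : H) : IsLUB {K.coset x, K.coset y} (K.coset (x ⊔ y)) := by
  refine ⟨by simp [K.coset_mono le_sup_left, K.coset_mono le_sup_right], ?_⟩
  rintro ⟨z⟩ hz
  obtain ⟨s, hs, hxz⟩ := hz (Set.mem_insert _ _)
  obtain ⟨t, ht, hyz⟩ := hz (Set.mem_insert_of_mem _ rfl)
  exact ⟨s ⊔ t, K.sup_mem' hs ht, (sup_le_sup hxz hyz).trans_eq (sup_mul s t z).symm⟩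

theorem isGLB_coset_inf (x y : H) : IsGLB {K.coset x, K.coset y} (K.coset (x ⊓ y)) := by
  refine ⟨by simp [K.coset_mono inf_le_left, K.coset_mono inf_le_right], ?_⟩
  rintro ⟨z⟩ hz
  obtain ⟨s, hs, hzx⟩ := hz (Set.mem_insert _ _)
  obtain ⟨t, ht, hzy⟩ := hz (Set.mem_insert_of_mem _ rfl)
  refine ⟨s ⊔ t, K.sup_mem' hs ht, ?_⟩
  rw [mul_inf]
  exact le_inf (hzx.trans (mul_le_mul_left le_sup_left x))
    (hzy.trans (mul_le_mul_left le_sup_right y))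

/-- Right multiplication `K y ↦ K (y x)` on right cosets. -/
def mulRight (x : H) : K.Cosets →o K.Cosets where
  toFun := Quotient.map (· * x) fun y z h => by
    rw [← Quotient.eq_iff_equiv] at h ⊢
    refine (K.coset_eq _ _).2 ?_
    simpa [mul_assoc] using (K.coset_eq y z).1 h
  monotone' := by
    rintro ⟨y⟩ ⟨z⟩ ⟨t, ht, h⟩
    exact ⟨t, ht, (mul_le_mul_left h x).trans_eq (mul_assoc t z x)⟩

theorem mulRight_coset (x y : H) : K.mulRight x (K.coset y) = K.coset (y * x) := rfl

theorem mulRight_mul (x y : H) (Z : K.Cosets) :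
    K.mulRight (x * y) Z = K.mulRight y (K.mulRight x Z) := by
  obtain ⟨z, rfl⟩ := K.coset_surjective Z
  simp only [mulRight_coset, mul_assoc]

theorem mulRight_one (Z : K.Cosets) : K.mulRight 1 Z = Z := by
  obtain ⟨z, rfl⟩ := K.coset_surjective Z
  rw [mulRight_coset, mul_one]

end ConvexLSubgroup

namespace Spec

variable [MulLeftMono H] [MulRightMono H] (p : Spec H)

noncomputable instance : LinearOrder p.1.Cosets where
  le_total := p.2.2
  toDecidableLE := Classical.decRel _

/-- The projection of an `ℓ`-group to the chain of right cosets of a prime subgroup. -/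
noncomputable def cosetHom : LatticeHom H p.1.Cosets where
  toFun := p.1.coset
  map_sup' x y := (p.1.isLUB_coset_sup x y).unique isLUB_pair
  map_inf' x y := (p.1.isGLB_coset_inf x y).unique isGLB_pair

theorem cosetHom_apply (x : H) : p.cosetHom x = p.1.coset x := rfl

theorem sup_one_mem_iff {x : H} : x ⊔ 1 ∈ p.1 ↔ p.1.coset x ≤ p.1.coset 1 := by
  rw [← p.1.coset_eq_coset_one, ← cosetHom_apply, map_sup]
  exact sup_eq_right

/-- The action of an `ℓ`-group by right multiplication on the chain of right cosets of a prime
subgroup. -/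
noncomputable def cosetAction : LHom H (ChainAut p.1.Cosets) where
  toFun x := Equiv.toOrderIso
    { toFun := p.1.mulRight x
      invFun := p.1.mulRight x⁻¹
      left_inv Z := by rw [← p.1.mulRight_mul, mul_inv_cancel, p.1.mulRight_one]
      right_inv Z := by rw [← p.1.mulRight_mul, inv_mul_cancel, p.1.mulRight_one] }
    (p.1.mulRight x).monotone (p.1.mulRight x⁻¹).monotone
  map_one' := ChainAut.ext p.1.mulRight_one
  map_mul' x y := ChainAut.ext (p.1.mulRight_mul x y)
  map_sup' x y := ChainAut.ext fun Z => by
    obtain ⟨z, rfl⟩ := p.1.coset_surjective Z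
    exact (congrArg p.1.coset (mul_sup x y z)).trans (map_sup p.cosetHom _ _)
  map_inf' x y := ChainAut.ext fun Z => by
    obtain ⟨z, rfl⟩ := p.1.coset_surjective Z
    exact (congrArg p.1.coset (mul_inf x y z)).trans (map_inf p.cosetHom _ _)

theorem cosetAction_apply (x y : H) : p.cosetAction x (p.1.coset y) = p.1.coset (y * x) := rfl

theorem cosetAction_coset_one (x : H) : p.cosetAction x (p.1.coset 1) = p.1.coset x := by
  rw [cosetAction_apply, one_mul]

end Spec

end Cosets

namespace PreCone

variable {G : Type*} [Group G] [PartialOrder G]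

section Omega

variable (C : PreCone G)

theorem one_le_cls {a : G} : C.cls 1 ≤ C.cls a ↔ a ∈ C := by
  rw [cls_le_cls, Rel, inv_one, mul_one]

theorem one_lt_cls {a : G} : C.cls 1 < C.cls a ↔ a ∈ C ∧ a⁻¹ ∉ C := by
  rw [lt_iff_le_not_ge, one_le_cls, cls_le_cls, Rel, one_mul]

theorem exists_cls_ne_one : ∃ a, C.cls a ≠ C.cls 1 := by
  by_contra! h
  exact C.proper' (Set.eq_univ_of_forall fun a => C.one_le_cls.1 (h a).ge)

/-- The map on the chain of classes induced by a map that is monotone for the right pre-order. -/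
noncomputable def liftOmega {α : Type*} [Lattice α] (f : G → α)
    (hf : ∀ a b, C.Rel a b → f a ≤ f b) : LatticeHom C.Omega α :=
  OrderHomClass.toLatticeHom C.Omega α
    { toFun := Quotient.lift (s := C.setoid) f fun a b h => (hf a b h.1).antisymm (hf b a h.2)
      monotone' := by
        rintro ⟨a⟩ ⟨b⟩ h
        exact hf a b h : C.Omega →o α }

theorem liftOmega_cls {α : Type*} [Lattice α] (f : G → α) (hf : ∀ a b, C.Rel a b → f a ≤ f b)
    (a : G) : C.liftOmega f hf (C.cls a) = f a := rfl

/-- Left translation on the chain of classes of a pre-order. -/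
noncomputable def mulLeft {C : PreCone G} (hC : C.IsPreorder) (t : G) :
    LatticeHom C.Omega C.Omega :=
  C.liftOmega (fun a => C.cls (t * a)) fun a b => hC a b t

theorem mulLeft_cls {C : PreCone G} (hC : C.IsPreorder) (t a : G) :
    mulLeft hC t (C.cls a) = C.cls (t * a) := rfl

end Omega

section OfAction

variable {Ω : Type*} [LinearOrder Ω] (ψ : G →*o ChainAut Ω) {ω : Ω} (hω : ∃ a, ψ a ω ≠ ω)

/-- The right pre-order that compares elements of `G` by their effect on a point of a chain on
which `G` acts. -/
def ofAction : PreCone G where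
  carrier := {a | ω ≤ ψ a ω}
  mul_mem' {a b} ha hb := by
    rw [Set.mem_ofPred_eq, map_mul, ChainAut.mul_apply]
    exact hb.trans ((ψ b).mono ha)
  one_mem' := by rw [Set.mem_ofPred_eq, map_one, ChainAut.one_apply]
  proper' h := by
    obtain ⟨a, ha⟩ := hω
    have le_apply (b : G) : ω ≤ ψ b ω := h.superset (Set.mem_univ b)
    have apply_le := le_apply a⁻¹
    rw [map_inv, ChainAut.le_inv_apply_iff] at apply_le
    exact ha (apply_le.antisymm (le_apply a))
  total' a := by
    rw [Set.mem_ofPred_eq, Set.mem_ofPred_eq, map_inv, ChainAut.le_inv_apply_iff]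
    exact le_total _ _
  pos_mem' a ha := by
    have h := OrderHomClass.mono ψ ha ω
    rwa [map_one, ChainAut.one_apply] at h

theorem mem_ofAction {a : G} : a ∈ ofAction ψ hω ↔ ω ≤ ψ a ω := Iff.rfl

theorem ofAction_rel {a b : G} : (ofAction ψ hω).Rel a b ↔ ψ a ω ≤ ψ b ω := by
  rw [Rel, mem_ofAction, map_mul, map_inv, ChainAut.mul_apply, ChainAut.le_inv_apply_iff]

variable (hsurj : Function.Surjective fun a => ψ a ω)

/-- The classes of the right pre-order of a transitive action are the points of the chain. -/
noncomputable def ofActionOmegaIso : (ofAction ψ hω).Omega ≃o Ω :=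
  StrictMono.orderIsoOfSurjective
    ((ofAction ψ hω).liftOmega (fun a => ψ a ω) fun _ _ => (ofAction_rel ψ hω).1)
    (by
      rintro ⟨a⟩ ⟨b⟩ h
      exact lt_of_not_ge fun h' => h.not_ge ((ofAction_rel ψ hω).2 h'))
    fun x => (hsurj x).imp' (ofAction ψ hω).cls fun _ => id

theorem ofActionOmegaIso_rho (a : G) (x : (ofAction ψ hω).Omega) :
    ofActionOmegaIso ψ hω hsurj ((ofAction ψ hω).rho a x) =
      ψ a (ofActionOmegaIso ψ hω hsurj x) := by
  obtain ⟨b⟩ := x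
  change ψ (b * a) ω = ψ a (ψ b ω)
  rw [map_mul, ChainAut.mul_apply]

include hsurj in
theorem inVariety_HSub_ofAction {E : Equations} {H : Type*} [Group H] [Lattice H]
    (hH : InVariety E H) (f : LHom H (ChainAut Ω)) (hf : ∀ a, ψ a ∈ f.range) :
    InVariety E (ofAction ψ hω).HSub := by
  let e := ofActionOmegaIso ψ hω hsurj
  refine hH.of_le_range ((ChainAut.congr e.symm).comp f) fun x hx => hx _ ?_
  rintro _ ⟨a, rfl⟩
  obtain ⟨z, hz⟩ := hf a
  refine ⟨z, ChainAut.ext fun y => e.symm_apply_eq.2 ?_⟩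
  exact (DFunLike.congr_fun hz (e y)).trans (ofActionOmegaIso_rho ψ hω hsurj a y).symm

end OfAction

end PreCone

section Correspondence

variable {G : Type*} [Group G] [PartialOrder G] {E : Equations}

namespace Spec

variable (p : Spec (FreeLGroup E G))

/-- The action of `G` on the chain of right cosets of a prime subgroup of its free `ℓ`-group. -/
noncomputable def etaAction : G →*o ChainAut p.1.Cosets :=
  p.cosetAction.toOrderMonoidHom.comp (FreeLGroup.eta E G)

theorem etaAction_coset_one (a : G) :
    p.etaAction a (p.1.coset 1) = p.1.coset (FreeLGroup.eta E G a) :=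
  p.cosetAction_coset_one _

theorem exists_coset_eta_eq (X : p.1.Cosets) : ∃ a, p.1.coset (FreeLGroup.eta E G a) = X := by
  obtain ⟨x, rfl⟩ := p.1.coset_surjective X
  exact FreeLGroup.exists_apply_eta_eq p.cosetHom x

theorem etaAction_surjective : Function.Surjective fun a => p.etaAction a (p.1.coset 1) := by
  simpa only [Function.Surjective, etaAction_coset_one] using p.exists_coset_eta_eq

theorem exists_etaAction_ne : ∃ a, p.etaAction a (p.1.coset 1) ≠ p.1.coset 1 := by
  obtain ⟨x, hx⟩ := (Set.ne_univ_iff_exists_notMem _).1 p.2.1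
  obtain ⟨a, ha⟩ := p.etaAction_surjective (p.1.coset x)
  exact ⟨a, ha.trans_ne (mt p.1.coset_eq_coset_one.1 hx)⟩

/-- The map `π` from prime subgroups of the free `ℓ`-group to right pre-orders. -/
noncomputable def toRightPreorder : RightPreorders E G :=
  ⟨.ofAction p.etaAction p.exists_etaAction_ne,
    PreCone.inVariety_HSub_ofAction _ _ p.etaAction_surjective (FreeLGroup.inVariety E G)
      p.cosetAction fun a => ⟨FreeLGroup.eta E G a, rfl⟩⟩

theorem toRightPreorder_rel {a b : G} : p.toRightPreorder.1.Rel a b ↔ piRel p a b := by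
  rw [piRel, ← etaAction_coset_one, ← etaAction_coset_one]
  exact PreCone.ofAction_rel p.etaAction p.exists_etaAction_ne

theorem mem_toRightPreorder {a : G} : a ∈ p.toRightPreorder.1 ↔ piRel p 1 a := by
  rw [← toRightPreorder_rel, ← PreCone.cls_le_cls, PreCone.one_le_cls]

variable {p} in
theorem toRightPreorder_mono {q : Spec (FreeLGroup E G)}
    (h : (p.1 : Set (FreeLGroup E G)) ⊆ q.1) :
    (p.toRightPreorder.1 : Set G) ⊆ q.toRightPreorder.1 := fun _ ha => by
  obtain ⟨t, ht, hle⟩ := p.mem_toRightPreorder.1 ha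
  exact q.mem_toRightPreorder.2 ⟨t, h ht, hle⟩

variable {p} in
theorem isPreorder_toRightPreorder (hp : p.1.toSubgroup.Normal) :
    p.toRightPreorder.1.IsPreorder := fun a b t h => by
  rw [toRightPreorder_rel, piRel, map_mul, map_mul]
  exact p.1.coset_mul_left_le _ (p.toRightPreorder_rel.1 h)

theorem continuous_toRightPreorder :
    Continuous (toRightPreorder : Spec (FreeLGroup E G) → RightPreorders E G) := by
  refine continuous_generateFrom_iff.2 ?_
  rintro _ ⟨a, rfl⟩
  refine ⟨{FreeLGroup.eta E G a ⊔ 1}, Set.ext fun p => ?_⟩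
  calc a ∈ p.toRightPreorder.1 ∧ a⁻¹ ∉ p.toRightPreorder.1
    _ ↔ ¬ p.toRightPreorder.1.Rel a 1 := by
      rw [← PreCone.one_lt_cls, ← not_le, PreCone.cls_le_cls]
    _ ↔ FreeLGroup.eta E G a ⊔ 1 ∉ p.1 := by
      rw [toRightPreorder_rel, piRel, map_one]
      exact not_congr p.sup_one_mem_iff.symm
    _ ↔ p ∈ support {FreeLGroup.eta E G a ⊔ 1} := not_congr Set.singleton_subset_iff.symm

end Spec

variable [MulLeftMono G] [MulRightMono G]

namespace RightPreorders

variable (C : RightPreorders E G)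

/-- The action of the free `ℓ`-group on the chain of classes of a right pre-order. -/
noncomputable def action : LHom (FreeLGroup E G) (ChainAut C.1.Omega) := C.1.HSub.subtype.comp C.hom

theorem action_eta_cls (a b : G) : C.action (FreeLGroup.eta E G a) (C.1.cls b) = C.1.cls (b * a) :=
  rfl

/-- The orbit map of the class of the identity. -/
noncomputable def orbitHom : LatticeHom (FreeLGroup E G) C.1.Omega := C.action.orbit (C.1.cls 1)

theorem orbitHom_eta (a : G) : C.orbitHom (FreeLGroup.eta E G a) = C.1.cls a := by
  rw [orbitHom, LHom.orbit_apply, action_eta_cls, one_mul]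

theorem orbitHom_one : C.orbitHom 1 = C.1.cls 1 := C.action.orbit_one _

/-- The map `κ` from right pre-orders to prime subgroups of the free `ℓ`-group. -/
noncomputable def toSpec : Spec (FreeLGroup E G) :=
  ⟨C.action.stabilizer (C.1.cls 1), by
    obtain ⟨a, ha⟩ := C.1.exists_cls_ne_one
    exact C.action.stabilizer_isPrime _ (ne_of_eq_of_ne (C.orbitHom_eta a) ha)⟩

theorem mem_toSpec {x : FreeLGroup E G} : x ∈ C.toSpec.1 ↔ C.orbitHom x = C.1.cls 1 := Iff.rfl

theorem toSpec_coset_le_coset {x y : FreeLGroup E G} :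
    C.toSpec.1.coset x ≤ C.toSpec.1.coset y ↔ C.orbitHom x ≤ C.orbitHom y :=
  C.action.stabilizer_coset_le_coset _

variable {C} in
theorem toSpec_mono {D : RightPreorders E G} (h : (C.1 : Set G) ⊆ D.1) :
    (C.toSpec.1 : Set (FreeLGroup E G)) ⊆ D.toSpec.1 := by
  let f := C.1.liftOmega D.1.cls fun _ _ hab => h hab
  have hf : f.comp C.orbitHom = D.orbitHom := FreeLGroup.latticeHom_ext fun a => by
    rw [LatticeHom.comp_apply, orbitHom_eta, orbitHom_eta]
    exact C.1.liftOmega_cls _ _ a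
  intro x hx
  calc D.orbitHom x = f (C.orbitHom x) := (DFunLike.congr_fun hf x).symm
    _ = f (C.1.cls 1) := congrArg f hx
    _ = D.1.cls 1 := C.1.liftOmega_cls _ _ 1

end RightPreorders

namespace Spec

variable (p : Spec (FreeLGroup E G))

/-- The classes of the right pre-order of a prime subgroup are its cosets. -/
noncomputable def omegaIso : p.toRightPreorder.1.Omega ≃o p.1.Cosets :=
  PreCone.ofActionOmegaIso p.etaAction p.exists_etaAction_ne p.etaAction_surjective

theorem omegaIso_orbitHom (x : FreeLGroup E G) :
    p.omegaIso (p.toRightPreorder.orbitHom x) = p.1.coset x := by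
  have h : (OrderHomClass.toLatticeHom _ _ p.omegaIso).comp p.toRightPreorder.orbitHom =
      p.cosetHom := FreeLGroup.latticeHom_ext fun a => by
    rw [LatticeHom.comp_apply, RightPreorders.orbitHom_eta]
    exact p.etaAction_coset_one a
  exact DFunLike.congr_fun h x

theorem toSpec_toRightPreorder : p.toRightPreorder.toSpec = p := by
  refine Subtype.ext (SetLike.ext fun x => ?_)
  rw [RightPreorders.mem_toSpec, ← p.omegaIso.injective.eq_iff,
    ← p.toRightPreorder.orbitHom_one, omegaIso_orbitHom, omegaIso_orbitHom,
    ConvexLSubgroup.coset_eq_coset_one]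

end Spec

theorem RightPreorders.toRightPreorder_toSpec (C : RightPreorders E G) :
    C.toSpec.toRightPreorder = C := by
  refine Subtype.ext (SetLike.ext fun a => ?_)
  rw [Spec.mem_toRightPreorder, piRel, toSpec_coset_le_coset, orbitHom_eta, orbitHom_eta,
    PreCone.one_le_cls]

namespace RightPreorders

theorem action_mulLeft {C : RightPreorders E G} (hC : C.1.IsPreorder) (x : FreeLGroup E G) (t : G)
    (w : C.1.Omega) :
    C.action x (PreCone.mulLeft hC t w) = PreCone.mulLeft hC t (C.action x w) := by
  obtain ⟨b⟩ := w
  let l := PreCone.mulLeft hC t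
  have h : C.action.orbit (l (C.1.cls b)) = l.comp (C.action.orbit (C.1.cls b)) :=
    FreeLGroup.latticeHom_ext fun a => congrArg C.1.cls (mul_assoc t b a)
  exact DFunLike.congr_fun h x

theorem normal_toSpec {C : RightPreorders E G} (hC : C.1.IsPreorder) :
    C.toSpec.1.toSubgroup.Normal := by
  refine C.action.stabilizer_normal _ fun x hx => ChainAut.ext ?_
  rintro ⟨t⟩
  calc C.action x (C.1.cls t)
    _ = C.action x (PreCone.mulLeft hC t (C.1.cls 1)) := by rw [PreCone.mulLeft_cls, mul_one]
    _ = PreCone.mulLeft hC t (C.action x (C.1.cls 1)) := action_mulLeft hC x t _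
    _ = PreCone.mulLeft hC t (C.1.cls 1) := congrArg _ hx
    _ = C.1.cls t := by rw [PreCone.mulLeft_cls, mul_one]

theorem mem_preorders_iff (C : RightPreorders E G) :
    C ∈ Preorders E G ↔ C.toSpec ∈ SpecStar (FreeLGroup E G) :=
  ⟨normal_toSpec, fun h => C.toRightPreorder_toSpec ▸ Spec.isPreorder_toRightPreorder h⟩

theorem isOpen_one_lt_orbitHom (x : FreeLGroup E G) :
    IsOpen {C : RightPreorders E G | C.1.cls 1 < C.orbitHom x} := by
  refine latticeClosure_min (t := {x | IsOpen {C : RightPreorders E G | C.1.cls 1 < C.orbitHom x}})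
    ?_ ⟨fun x hx y hy => ?_, fun x hx y hy => ?_⟩ (FreeLGroup.mem_latticeClosure_range_eta x)
  · rintro _ ⟨a, rfl⟩
    simp only [Set.mem_ofPred_eq, orbitHom_eta, PreCone.one_lt_cls]
    exact TopologicalSpace.isOpen_generateFrom_of_mem ⟨a, rfl⟩
  · simp only [Set.mem_ofPred_eq, map_sup, lt_sup_iff] at hx hy ⊢
    exact hx.union hy
  · simp only [Set.mem_ofPred_eq, map_inf, lt_inf_iff] at hx hy ⊢
    exact hx.inter hy

theorem notMem_toSpec {C : RightPreorders E G} {x : FreeLGroup E G} :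
    x ∉ C.toSpec.1 ↔ C.1.cls 1 < C.orbitHom |x|ₘ := by
  rw [← C.toSpec.1.mabs_mem_iff, mem_toSpec, ← orbitHom_one,
    (OrderHomClass.mono C.orbitHom (one_le_mabs x)).lt_iff_ne']

theorem continuous_toSpec : Continuous (toSpec : RightPreorders E G → Spec (FreeLGroup E G)) where
  isOpen_preimage := by
    rintro _ ⟨A, rfl⟩
    have h : toSpec ⁻¹' Spec.support A =
        ⋃ x ∈ A, {C : RightPreorders E G | C.1.cls 1 < C.orbitHom |x|ₘ} := by
      ext C
      simp [Spec.support, Set.not_subset, notMem_toSpec]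
    rw [h]
    exact isOpen_biUnion fun x _ => isOpen_one_lt_orbitHom _

end RightPreorders

/-- The homeomorphism `κ` between right pre-orders and prime subgroups of the free `ℓ`-group,
with inverse `π`. -/
noncomputable def spectrumHomeomorph (E : Equations) (G : Type*) [Group G] [PartialOrder G]
    [MulLeftMono G] [MulRightMono G] : RightPreorders E G ≃ₜ Spec (FreeLGroup E G) where
  toFun := RightPreorders.toSpec
  invFun := Spec.toRightPreorder
  left_inv := RightPreorders.toRightPreorder_toSpec
  right_inv := Spec.toSpec_toRightPreorder
  continuous_toFun := RightPreorders.continuous_toSpec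
  continuous_invFun := Spec.continuous_toRightPreorder

end Correspondence

end LGrp

theorem theorem2p5 (G : Type u) [Group G] [PartialOrder G] [MulLeftMono G] [MulRightMono G]
    (E : Equations) :
    ∃ (κ : RightPreorders E G → Spec (FreeLGroup E G))
      (π : Spec (FreeLGroup E G) → RightPreorders E G),
      -- the two maps are the ones given by the explicit formulas
      (∀ C, ((κ C).1 : Set (FreeLGroup E G)) = kappaSet C) ∧
      (∀ p, ((π p).1 : Set G) = piSet p) ∧
      (∀ p a b, (π p).1.Rel a b ↔ piRel p a b) ∧
      -- mutually inverse
      Function.LeftInverse π κ ∧ Function.RightInverse π κ ∧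
      -- inclusion-preserving
      (∀ C D, (C.1 : Set G) ⊆ D.1 → ((κ C).1 : Set (FreeLGroup E G)) ⊆ (κ D).1) ∧
      (∀ p q, (p.1 : Set (FreeLGroup E G)) ⊆ q.1 → ((π p).1 : Set G) ⊆ (π q).1) ∧
      -- homeomorphisms
      IsHomeomorph κ ∧ IsHomeomorph π ∧
      -- the restrictions to pre-orders and prime ideals
      ∃ (hκ : Set.MapsTo κ (Preorders E G) (SpecStar (FreeLGroup E G)))
        (hπ : Set.MapsTo π (SpecStar (FreeLGroup E G)) (Preorders E G)),
        IsHomeomorph (hκ.restrict κ _ _) ∧ IsHomeomorph (hπ.restrict π _ _) := by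
  let Φ := spectrumHomeomorph E G
  exact ⟨Φ, Φ.symm, fun _ => rfl, fun p => Set.ext fun _ => p.mem_toRightPreorder,
    fun p _ _ => p.toRightPreorder_rel, Φ.left_inv, Φ.right_inv,
    fun _ _ => RightPreorders.toSpec_mono, fun _ _ => Spec.toRightPreorder_mono,
    Φ.isHomeomorph, Φ.symm.isHomeomorph,
    fun C => C.mem_preorders_iff.1, fun _ => Spec.isPreorder_toRightPreorder,
    (Φ.subtype RightPreorders.mem_preorders_iff).isHomeomorph,
    (Φ.subtype RightPreorders.mem_preorders_iff).symm.isHomeomorph⟩
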